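/- Let $\Gamma=(X,R)$ be a finite simple connected graph with path-length distance $\partial$ and diameter $D$. Assume that $\Gamma$ is distance-regular, i.e. for all $0\le h,i,j\le D$ the number $p^h_{ij}=|\{z\in X:\partial(y,z)=i,\ \partial(z,w)=j\}|$ is the same for all $y,w\in X$ with $\partial(y,w)=h$; that $\Gamma$ is bipartite; that $D\ge 4$; and that the valency $k$ is at least $3$. Put $b_i=p^i_{1,i+1}$ $(0\le i\le D-1)$. For $0\le i\le D$ let $A_i\in\mathrm{Mat}_X(\mathbb C)$ be the $i$-th distance matrix, with $(y,w)$-entry $1$ if $\partial(y,w)=i$ and $0$ otherwise, let $A=A_1$ be the adjacency matrix, and let $M$ be the subalgebra of $\mathrm{Mat}_X(\mathbb C)$ generated by $A$. Let $\theta_0>\theta_1>\cdots>\theta_D$ be the distinct eigenvalues of $A$, let $E_i$ be the primitive idempotent of $M$ associated with $\theta_i$ (the projection onto the $\theta_i$-eigenspace of $A$ that vanishes on all the other eigenspaces), and let $d=\lfloor D/2\rfloor$. For real $z$ with $z^2\ne b_2$ put $$\tilde z=-1-\frac{b_2b_3}{z^2-b_2}$$ (it is known that $\theta_1^2>b_2>\theta_d^2$).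 Fix $x\in X$. For $0\le i\le D$ let $E_i^*\in\mathrm{Mat}_X(\mathbb C)$ be the diagonal matrix whose $(y,y)$-entry is $1$ if $\partial(x,y)=i$ and $0$ otherwise, and let $T$ be the subalgebra of $\mathrm{Mat}_X(\mathbb C)$ generated by $A,E_0^*,\dots,E_D^*$. A $T$-module is a subspace $W\subseteq\mathbb C^X$ with $BW\subseteq W$ for all $B\in T$; it is irreducible if $W\neq 0$ and the only $T$-modules contained in $W$ are $0$ and $W$. An irreducible $T$-module $W$ is thin if $\dim E_i^*W\le 1$ for $0\le i\le D$, and its endpoint is $\min\{i: 0\le i\le D,\ E_i^*W\ne 0\}$. If $W$ is thin, irreducible and has endpoint $2$, then $E_2^*W$ is one-dimensional and its nonzero vectors are eigenvectors of $E_2^*A_2E_2^*$; the corresponding (real) eigenvalue $\eta$ is called the local eigenvalue of $W$. **Theorem.** Let $W$ be a thin irreducible $T$-module with endpoint $2$ and local eigenvalue $\eta$, where $\tilde\theta_1<\eta<\tilde\theta_d$. Then $\dim W=D-1$. For every nonzero vector $v\in E_2^*W$ we have $W=Mv$, the vectors $E_1v,E_2v,\dots,E_{D-1}v$ form a basis of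 $W$, and $E_0v=E_Dv=0$. For $0\le i\le D$, the space $E_i^*W$ is zero if $i\in\{0,1\}$ and has dimension $1$ if $2\le i\le D$; and the space $E_iW$ is zero if $i\in\{0,D\}$ and has dimension $1$ if $1\le i\le D-1$. -/

import Mathlib

open Polynomial

noncomputable section

namespace SimpleGraph

variable {X : Type*}

/-- The `i`-th distance matrix `A_i`. -/
def distMatrix (Γ : SimpleGraph X) (i : ℕ) : Matrix X X ℂ :=
  Matrix.of fun y z => if Γ.dist y z = i then 1 else 0

/-- The adjacency matrix `A = A_1`. -/
def adjA (Γ : SimpleGraph X) : Matrix X X ℂ := Γ.distMatrix 1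

theorem adjA_apply (Γ : SimpleGraph X) [DecidableRel Γ.Adj] (y z : X) :
    Γ.adjA y z = if Γ.Adj y z then 1 else 0 := by
  simp [adjA, distMatrix, SimpleGraph.dist_eq_one_iff_adj]

variable [Fintype X]

/-- `Γ` is distance-regular: it is connected, and for all `0 ≤ h, i, j ≤ D` (`D` the diameter) the
number of `z` with `∂(y, z) = i` and `∂(z, w) = j` is the same for all pairs `(y, w)` with
`∂(y, w) = h`. -/
def IsDistanceRegular (Γ : SimpleGraph X) : Prop :=
  Γ.Connected ∧
    ∀ h i j : ℕ, h ≤ Γ.diam → i ≤ Γ.diam → j ≤ Γ.diam →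
      ∀ y w y' w' : X, Γ.dist y w = h → Γ.dist y' w' = h →
        (Finset.univ.filter fun z => Γ.dist y z = i ∧ Γ.dist z w = j).card =
          (Finset.univ.filter fun z => Γ.dist y' z = i ∧ Γ.dist z w' = j).card

open Classical in
/-- The intersection number `p^h_{ij}`: the number of `z` with `∂(y, z) = i` and `∂(z, w) = j`, for
a pair `(y, w)` with `∂(y, w) = h` (in a distance-regular graph the pair does not matter; the value
is `0` if there is no such pair). -/
def intersectionNumber (Γ : SimpleGraph X) (h i j : ℕ) : ℕ :=
  if hp : ∃ q : X × X, Γ.dist q.1 q.2 = h then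
    (Finset.univ.filter fun z => Γ.dist hp.choose.1 z = i ∧ Γ.dist z hp.choose.2 = j).card
  else 0

theorem IsDistanceRegular.intersectionNumber_eq {Γ : SimpleGraph X} (hΓ : Γ.IsDistanceRegular)
    {h i j : ℕ} (hh : h ≤ Γ.diam) (hi : i ≤ Γ.diam) (hj : j ≤ Γ.diam) {y w : X}
    (hyw : Γ.dist y w = h) :
    Γ.intersectionNumber h i j =
      (Finset.univ.filter fun z => Γ.dist y z = i ∧ Γ.dist z w = j).card := by
  have hp : ∃ q : X × X, Γ.dist q.1 q.2 = h := ⟨(y, w), hyw⟩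
  rw [intersectionNumber, dif_pos hp]
  exact hΓ.2 h i j hh hi hj _ _ _ _ hp.choose_spec hyw

/-- `b_i = p^i_{1, i+1}` for `i < D`; in particular `b_0` is the valency of the graph. -/
def bNumber (Γ : SimpleGraph X) (i : ℕ) : ℕ := Γ.intersectionNumber i 1 (i + 1)

variable [DecidableEq X]

theorem finite_eigenvalues (Γ : SimpleGraph X) :
    {t : ℝ | Module.End.HasEigenvalue (Matrix.toLin' Γ.adjA) (t : ℂ)}.Finite :=
  Set.Finite.preimage (Complex.ofReal_injective.injOn)
    (Module.End.finite_hasEigenvalue (Matrix.toLin' Γ.adjA))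

/-- The finite set of eigenvalues of `A` (all of which are real, `A` being real symmetric). -/
def eigenvalueFinset (Γ : SimpleGraph X) : Finset ℝ := Γ.finite_eigenvalues.toFinset

/-- `θ_i`: the entry in position `i` (counted from `0`) when the distinct eigenvalues of `A` are
listed in decreasing order. -/
def theta (Γ : SimpleGraph X) (i : ℕ) : ℝ :=
  (Γ.eigenvalueFinset.sort (fun s t => t ≤ s)).getD i 0

/-- The primitive idempotent `E_i` associated with `θ_i`, written as the polynomial in `A` that
takes the value `1` at `θ_i` and `0` at all other eigenvalues. -/
def primIdem (Γ : SimpleGraph X) (i : ℕ) : Matrix X X ℂ :=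
  aeval Γ.adjA ((Lagrange.basis Γ.eigenvalueFinset id (Γ.theta i)).map (algebraMap ℝ ℂ))

theorem primIdem_mulVec (Γ : SimpleGraph X) (i : ℕ) {s : ℝ} {v : X → ℂ}
    (hv : Γ.adjA.mulVec v = (s : ℂ) • v) :
    (Γ.primIdem i).mulVec v =
      (((Lagrange.basis Γ.eigenvalueFinset id (Γ.theta i)).eval s : ℝ) : ℂ) • v := by
  have h1 : Matrix.toLinAlgEquiv' (Γ.primIdem i) v =
      aeval (Matrix.toLinAlgEquiv' Γ.adjA)
        ((Lagrange.basis Γ.eigenvalueFinset id (Γ.theta i)).map (algebraMap ℝ ℂ)) v := by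
    rw [primIdem, ← aeval_algHom_apply]
  rw [Matrix.toLinAlgEquiv'_apply] at h1
  rw [h1, Module.End.aeval_apply_of_mem_apply_eq_smul (μ := (s : ℂ))]
  · congr 1
    rw [Polynomial.eval_map_algebraMap]
    exact Polynomial.aeval_algebraMap_apply_eq_algebraMap_eval s _
  · rw [Matrix.toLinAlgEquiv'_apply]; exact hv

/-- `E_i` is the identity on the eigenspace of `θ_i`. -/
theorem primIdem_mulVec_self (Γ : SimpleGraph X) {i : ℕ} (hi : Γ.theta i ∈ Γ.eigenvalueFinset)
    {v : X → ℂ} (hv : Γ.adjA.mulVec v = (Γ.theta i : ℂ) • v) :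
    (Γ.primIdem i).mulVec v = v := by
  have h := Lagrange.eval_basis_self (v := id) (s := Γ.eigenvalueFinset)
    Function.injective_id.injOn hi
  rw [id] at h
  rw [Γ.primIdem_mulVec i hv, h, Complex.ofReal_one, one_smul]

/-- `E_i` vanishes on the eigenspaces of the other eigenvalues. -/
theorem primIdem_mulVec_of_ne (Γ : SimpleGraph X) {i : ℕ} {s : ℝ} (hs : s ∈ Γ.eigenvalueFinset)
    (hsi : s ≠ Γ.theta i) {v : X → ℂ} (hv : Γ.adjA.mulVec v = (s : ℂ) • v) :
    (Γ.primIdem i).mulVec v = 0 := by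
  have h := Lagrange.eval_basis_of_ne (v := id) hsi.symm hs
  rw [id] at h
  rw [Γ.primIdem_mulVec i hv, h, Complex.ofReal_zero, zero_smul]

/-- The Bose-Mesner algebra `M`, generated by `A`. -/
def boseMesner (Γ : SimpleGraph X) : Subalgebra ℂ (Matrix X X ℂ) :=
  Algebra.adjoin ℂ {Γ.adjA}

/-- The dual idempotent `E*_i` with respect to `x`. -/
def dualIdem (Γ : SimpleGraph X) (x : X) (i : ℕ) : Matrix X X ℂ :=
  Matrix.diagonal fun y => if Γ.dist x y = i then 1 else 0

/-- The subconstituent (Terwilliger) algebra `T = T(x)`, generated by `A, E*_0, …, E*_D`. -/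
def subconstituentAlgebra (Γ : SimpleGraph X) (x : X) : Subalgebra ℂ (Matrix X X ℂ) :=
  Algebra.adjoin ℂ ({Γ.adjA} ∪ {B | ∃ i, i ≤ Γ.diam ∧ B = Γ.dualIdem x i})

/-- A `T`-module: a subspace `W` of the standard module `ℂ^X` with `BW ⊆ W` for all `B ∈ T`. -/
def IsTModule (Γ : SimpleGraph X) (x : X) (W : Submodule ℂ (X → ℂ)) : Prop :=
  ∀ B ∈ Γ.subconstituentAlgebra x, ∀ w ∈ W, B.mulVec w ∈ W

/-- An irreducible `T`-module. -/
def IsIrreducibleTModule (Γ : SimpleGraph X) (x : X) (W : Submodule ℂ (X → ℂ)) : Prop :=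
  Γ.IsTModule x W ∧ W ≠ ⊥ ∧
    ∀ W' : Submodule ℂ (X → ℂ), Γ.IsTModule x W' → W' ≤ W → W' = ⊥ ∨ W' = W

/-- The space `E*_i W`. -/
def dualPart (Γ : SimpleGraph X) (x : X) (i : ℕ) (W : Submodule ℂ (X → ℂ)) :
    Submodule ℂ (X → ℂ) :=
  W.map (Γ.dualIdem x i).mulVecLin

/-- The space `E_i W`. -/
def primPart (Γ : SimpleGraph X) (i : ℕ) (W : Submodule ℂ (X → ℂ)) : Submodule ℂ (X → ℂ) :=
  W.map (Γ.primIdem i).mulVecLin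

/-- `W` is thin: `dim E*_i W ≤ 1` for `0 ≤ i ≤ D`. -/
def IsThin (Γ : SimpleGraph X) (x : X) (W : Submodule ℂ (X → ℂ)) : Prop :=
  ∀ i ≤ Γ.diam, Module.finrank ℂ (Γ.dualPart x i W) ≤ 1

/-- `W` has endpoint `r`: `r` is the least `i` with `0 ≤ i ≤ D` and `E*_i W ≠ 0`. -/
def HasEndpoint (Γ : SimpleGraph X) (x : X) (W : Submodule ℂ (X → ℂ)) (r : ℕ) : Prop :=
  IsLeast {i | i ≤ Γ.diam ∧ Γ.dualPart x i W ≠ ⊥} r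

/-- `η` is the local eigenvalue of `W` (a thin irreducible `T`-module with endpoint `2`): the
nonzero elements of `E*_2 W` are eigenvectors of `E*_2 A_2 E*_2` with eigenvalue `η`. -/
def HasLocalEigenvalue (Γ : SimpleGraph X) (x : X) (W : Submodule ℂ (X → ℂ)) (η : ℝ) : Prop :=
  Γ.dualPart x 2 W ≠ ⊥ ∧
    ∀ w ∈ Γ.dualPart x 2 W,
      (Γ.dualIdem x 2 * Γ.distMatrix 2 * Γ.dualIdem x 2).mulVec w = (η : ℂ) • w

/-- `z̃ = -1 - b_2 b_3 / (z² - b_2)`, meant for real `z` with `z² ≠ b_2`. -/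
def tilde (Γ : SimpleGraph X) (z : ℝ) : ℝ :=
  -1 - (Γ.bNumber 2 : ℝ) * (Γ.bNumber 3 : ℝ) / (z ^ 2 - (Γ.bNumber 2 : ℝ))

/-- The subspace `Mv = {Bv : B ∈ M}`. -/
def boseMesnerOrbit (Γ : SimpleGraph X) (v : X → ℂ) : Submodule ℂ (X → ℂ) where
  carrier := {u | ∃ B ∈ Γ.boseMesner, B.mulVec v = u}
  add_mem' := by
    rintro _ _ ⟨B, hB, rfl⟩ ⟨C, hC, rfl⟩
    exact ⟨B + C, add_mem hB hC, Matrix.add_mulVec B C v⟩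
  zero_mem' := ⟨0, zero_mem _, Matrix.zero_mulVec v⟩
  smul_mem' := by
    rintro a _ ⟨B, hB, rfl⟩
    exact ⟨a • B, Γ.boseMesner.smul_mem hB a, Matrix.smul_mulVec a B v⟩

end SimpleGraph

end

open Polynomial

noncomputable section

namespace SimpleGraph

variable {X : Type*}

section DistanceClasses

/-! ### Distances in bipartite graphs -/

/-! The theorem is a dimension count. Thinness and endpoint 2 give dim W ≤ D - 1, since only E*_2 W,
…, E*_D W can be nonzero, each of dimension at most 1. For 0 ≠ v ∈ E*_2 W the vectors E_i v with 1 ≤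
i ≤ D - 1 lie in Mv ⊆ W and belong to distinct eigenvalues. Once they are nonzero they are
independent, so they span W, and every inequality is an equality.

The heart is thus `primIdem_mulVec_ne_zero`. Entries of E_i depend only on distance, say through f.
Two vertices at distance 2 from x lie at distance 0, 2 or 4, because Γ is bipartite. Since v sums to
zero and A_2 acts on it by η within that sphere, E_i v equals (f 0 + η f 2 - (1 + η) f 4) v there.
The three-term recurrence for f turns this scalar into a nonzero multiple of (k² - θ_i²)((1 +
η)(θ_i² - b_2) + b_2 b_3) (`three_term_identity`). Its vanishing would force η to be the tilde of
θ_i, which never lies strictly between the tildes of θ_1 and θ_d.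

For θ_0 = k and θ_D = -k the entries of the idempotent are f 0 times powers of ±1, hence constant up
to a sign fixed by parity, and they kill v because v sums to zero. -/

theorem IsBipartite.exists_even_dist_iff {Γ : SimpleGraph X} (hbip : Γ.IsBipartite)
    (hc : Γ.Connected) : ∃ c : X → Bool, ∀ y z, Even (Γ.dist y z) ↔ (c y ↔ c z) := by
  let c : Γ.Coloring Bool := hbip.toColoring (by simp)
  refine ⟨c, fun y z => ?_⟩
  obtain ⟨p, hp⟩ := hc.exists_walk_length_eq_dist y z
  rw [← hp, c.even_length_iff_congr p]

theorem IsBipartite.even_dist_iff {Γ : SimpleGraph X} (hbip : Γ.IsBipartite)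
    (hc : Γ.Connected) (x y z : X) :
    Even (Γ.dist y z) ↔ (Even (Γ.dist x y) ↔ Even (Γ.dist x z)) := by
  obtain ⟨c, h⟩ := hbip.exists_even_dist_iff hc
  rw [h, h, h]
  tauto

theorem Connected.exists_dist_eq_succ {Γ : SimpleGraph X} (hc : Γ.Connected) {y w : X} {j : ℕ}
    (hj : j < Γ.dist y w) : ∃ u v, Γ.dist y u = j ∧ Γ.dist u v = 1 ∧ Γ.dist y v = j + 1 := by
  obtain ⟨p, hp⟩ := hc.exists_walk_length_eq_dist y w
  have hadj : Γ.Adj (p.getVert j) (p.getVert (j + 1)) := p.adj_getVert_succ (by omega)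
  have h1 : ∀ i ≤ p.length, Γ.dist y (p.getVert i) = i := by
    intro i hi
    have h2 : Γ.dist y (p.getVert i) ≤ i := by
      have := dist_le (p.take i)
      rwa [p.take_length, min_eq_left hi] at this
    have h3 : Γ.dist (p.getVert i) w ≤ p.length - i := by
      have := dist_le (p.drop i)
      rwa [p.drop_length] at this
    have h4 : Γ.dist y w ≤ Γ.dist y (p.getVert i) + Γ.dist (p.getVert i) w := hc.dist_triangle
    omega
  exact ⟨_, _, h1 j (by omega), dist_eq_one_iff_adj.2 hadj, h1 (j + 1) (by omega)⟩

theorem Connected.exists_dist_eq {Γ : SimpleGraph X} (hc : Γ.Connected) {j : ℕ}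
    (hj : j ≤ Γ.diam) : ∃ y w, Γ.dist y w = j := by
  have := hc.nonempty
  obtain ⟨y, w, h⟩ := Γ.exists_dist_eq_diam
  rcases hj.eq_or_lt with rfl | hj
  · exact ⟨y, w, h⟩
  · obtain ⟨u, -, hu, -⟩ := hc.exists_dist_eq_succ (h ▸ hj)
    exact ⟨y, u, hu⟩

variable [Fintype X]

theorem Connected.dist_le_diam {Γ : SimpleGraph X} (hc : Γ.Connected) (y z : X) :
    Γ.dist y z ≤ Γ.diam := by
  have := hc.nonempty
  exact SimpleGraph.dist_le_diam (connected_iff_ediam_ne_top.1 hc)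

/-! ### Intersection numbers -/

namespace IsDistanceRegular

variable {Γ : SimpleGraph X}

theorem bNumber_eq (hΓ : Γ.IsDistanceRegular) {h : ℕ} (hh : h < Γ.diam) {y w : X}
    (hyw : Γ.dist y w = h) :
    Γ.bNumber h = (Finset.univ.filter fun z => Γ.dist y z = 1 ∧ Γ.dist z w = h + 1).card :=
  hΓ.intersectionNumber_eq hh.le (by omega) (by omega) hyw

theorem bNumber_zero_eq (hΓ : Γ.IsDistanceRegular) (hD : 0 < Γ.diam) (y : X) :
    Γ.bNumber 0 = (Finset.univ.filter fun z => Γ.dist y z = 1).card := by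
  rw [hΓ.bNumber_eq hD (w := y) dist_self]
  congr 1
  ext z
  simp [Γ.dist_comm (u := z)]

theorem bNumber_pos (hΓ : Γ.IsDistanceRegular) {h : ℕ} (hh : h < Γ.diam) : 0 < Γ.bNumber h := by
  obtain ⟨y, w, hyw⟩ := hΓ.1.exists_dist_eq le_rfl
  obtain ⟨u, v, hu, huv, hv⟩ := hΓ.1.exists_dist_eq_succ (hyw.symm ▸ hh)
  rw [dist_comm] at hu hv
  rw [hΓ.bNumber_eq hh hu, Finset.card_pos]
  exact ⟨v, by simp [huv, hv]⟩

theorem dist_eq_or_of_adj (hΓ : Γ.IsDistanceRegular) (hbip : Γ.IsBipartite) {y z : X} (w : X)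
    (hyz : Γ.dist y z = 1) :
    Γ.dist z w = Γ.dist y w + 1 ∨ (0 < Γ.dist y w ∧ Γ.dist z w = Γ.dist y w - 1) := by
  have h1 : Γ.dist z w ≤ Γ.dist z y + Γ.dist y w := hΓ.1.dist_triangle
  have h2 : Γ.dist y w ≤ Γ.dist y z + Γ.dist z w := hΓ.1.dist_triangle
  have h3 := hbip.even_dist_iff hΓ.1 y z w
  have h4 : Γ.dist z y = 1 := by rw [dist_comm, hyz]
  rw [hyz] at h3
  have h5 : Γ.dist z w ≠ Γ.dist y w := by
    intro h
    rw [h] at h3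
    grind
  omega

/-- This is c_h + b_h = k: in a bipartite graph no neighbour of y is as far from w as y is. -/
theorem card_filter_pred (hΓ : Γ.IsDistanceRegular) (hbip : Γ.IsBipartite) {h : ℕ} (h0 : 0 < h)
    (hh : h < Γ.diam) {y w : X} (hyw : Γ.dist y w = h) :
    (Finset.univ.filter fun z => Γ.dist y z = 1 ∧ Γ.dist z w = h - 1).card + Γ.bNumber h =
      Γ.bNumber 0 := by
  classical
  rw [hΓ.bNumber_eq hh hyw, hΓ.bNumber_zero_eq (by omega) y, ← Finset.card_union_of_disjoint]
  · congr 1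
    ext z
    simp only [Finset.mem_union, Finset.mem_filter, Finset.mem_univ, true_and]
    refine ⟨by tauto, fun hz => ?_⟩
    have := hΓ.dist_eq_or_of_adj hbip w hz
    rw [hyw] at this
    tauto
  · rw [Finset.disjoint_left]
    intro z
    simp only [Finset.mem_filter, Finset.mem_univ, true_and]
    omega

theorem bNumber_one (hΓ : Γ.IsDistanceRegular) (hbip : Γ.IsBipartite) (hD : 1 < Γ.diam) :
    1 + Γ.bNumber 1 = Γ.bNumber 0 := by
  obtain ⟨y, w, hyw⟩ := hΓ.1.exists_dist_eq hD.le
  rw [← hΓ.card_filter_pred hbip one_pos hD hyw]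
  congr 1
  symm
  rw [Finset.card_eq_one]
  refine ⟨w, ?_⟩
  ext z
  simp only [Finset.mem_filter, Finset.mem_univ, true_and, Finset.mem_singleton, Nat.sub_self]
  rw [hΓ.1.dist_eq_zero_iff]
  exact ⟨fun h => h.2, fun h => ⟨h ▸ hyw, h⟩⟩

end IsDistanceRegular

/-! ### Matrices that are constant on the distance classes -/

theorem adjA_mul_apply (Γ : SimpleGraph X) (B : Matrix X X ℂ) (y w : X) :
    (Γ.adjA * B) y w = ∑ z with Γ.dist y z = 1, B z w := by
  simp [Matrix.mul_apply, adjA, distMatrix, Finset.sum_filter]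

theorem adjA_mulVec_apply (Γ : SimpleGraph X) (v : X → ℂ) (y : X) :
    Γ.adjA.mulVec v y = ∑ z with Γ.dist y z = 1, v z := by
  simp [Matrix.mulVec, dotProduct, adjA, distMatrix, Finset.sum_filter]

namespace IsDistanceRegular

variable {Γ : SimpleGraph X}

theorem adjA_mul_apply_eq (hΓ : Γ.IsDistanceRegular) {B : Matrix X X ℂ} {f : ℕ → ℂ}
    (hf : ∀ y w, B y w = f (Γ.dist y w)) {y w y' w' : X} (h : Γ.dist y w = Γ.dist y' w') :
    (Γ.adjA * B) y w = (Γ.adjA * B) y' w' := by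
  -- The count of neighbours uses index 1, which regularity covers only when the diameter is
  -- positive.
  by_cases hD : Γ.diam = 0
  · have hz : ∀ a b, Γ.dist a b = 0 := fun a b => by have := hΓ.1.dist_le_diam a b; omega
    simp [adjA_mul_apply, hz]
  have key : ∀ y w, (Γ.adjA * B) y w = ∑ j ∈ Finset.range (Γ.diam + 1),
      ((Finset.univ.filter fun z => Γ.dist y z = 1 ∧ Γ.dist z w = j).card : ℂ) * f j := by
    intro y w
    rw [adjA_mul_apply, ← Finset.sum_fiberwise_of_maps_to (g := fun z => Γ.dist z w)
      (t := Finset.range (Γ.diam + 1))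
      (fun z _ => Finset.mem_range.2 (Nat.lt_succ_of_le (hΓ.1.dist_le_diam z w)))]
    refine Finset.sum_congr rfl fun j _ => ?_
    rw [Finset.filter_filter, ← nsmul_eq_mul, ← Finset.sum_const]
    refine Finset.sum_congr rfl fun z hz => ?_
    rw [hf, (Finset.mem_filter.1 hz).2.2]
  rw [key, key]
  refine Finset.sum_congr rfl fun j hj => ?_
  rw [hΓ.2 (Γ.dist y w) 1 j (hΓ.1.dist_le_diam y w) (by omega)
    (Nat.le_of_lt_succ (Finset.mem_range.1 hj)) y w y' w' rfl h.symm]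

/-- Multiplication by A preserves constancy on distance classes, so induction on powers suffices. -/
theorem exists_aeval_adjA_apply [DecidableEq X] (hΓ : Γ.IsDistanceRegular) (p : ℂ[X]) :
    ∃ f : ℕ → ℂ, ∀ y w, aeval Γ.adjA p y w = f (Γ.dist y w) := by
  suffices h : ∀ n : ℕ, ∃ f : ℕ → ℂ, ∀ y w, (Γ.adjA ^ n) y w = f (Γ.dist y w) by
    choose f hf using h
    refine ⟨fun d => ∑ n ∈ Finset.range (p.natDegree + 1), p.coeff n * f n d, fun y w => ?_⟩
    rw [aeval_eq_sum_range, Matrix.sum_apply]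
    exact Finset.sum_congr rfl fun n _ => by rw [Matrix.smul_apply, hf, smul_eq_mul]
  intro n
  induction n with
  | zero =>
    refine ⟨fun d => if d = 0 then 1 else 0, fun y w => ?_⟩
    simp [Matrix.one_apply, hΓ.1.dist_eq_zero_iff]
  | succ n ih =>
    obtain ⟨f, hf⟩ := ih
    classical
    -- The value at d is read off from any pair at distance d; the default 0 concerns only distances
    -- that do not occur.
    refine ⟨fun d => if h : ∃ q : X × X, Γ.dist q.1 q.2 = d then
      (Γ.adjA * Γ.adjA ^ n) h.choose.1 h.choose.2 else 0, fun y w => ?_⟩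
    have h : ∃ q : X × X, Γ.dist q.1 q.2 = Γ.dist y w := ⟨(y, w), rfl⟩
    rw [pow_succ']
    refine Eq.trans ?_ (dif_pos h).symm
    exact hΓ.adjA_mul_apply_eq hf h.choose_spec.symm

theorem recurrence_zero (hΓ : Γ.IsDistanceRegular) (hD : 0 < Γ.diam) {B : Matrix X X ℂ}
    {f : ℕ → ℂ} (hf : ∀ y w, B y w = f (Γ.dist y w)) {t : ℂ} (ht : Γ.adjA * B = t • B) :
    (Γ.bNumber 0 : ℂ) * f 1 = t * f 0 := by
  obtain ⟨y, w, hyw⟩ := hΓ.1.exists_dist_eq (Nat.zero_le Γ.diam)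
  obtain rfl := hΓ.1.dist_eq_zero_iff.1 hyw
  have h := congrFun (congrFun ht y) y
  rw [adjA_mul_apply, Matrix.smul_apply, hf, dist_self, smul_eq_mul] at h
  rw [← h, hΓ.bNumber_zero_eq hD y, ← nsmul_eq_mul, ← Finset.sum_const]
  refine Finset.sum_congr rfl fun z hz => ?_
  rw [hf, dist_comm, (Finset.mem_filter.1 hz).2]

/-- Compare the (y, w) entries of A B = t B at distance h; the coefficient of f (h - 1) is c_h = k -
b_h. -/
theorem recurrence (hΓ : Γ.IsDistanceRegular) (hbip : Γ.IsBipartite) {h : ℕ} (h0 : 0 < h)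
    (hh : h < Γ.diam) {B : Matrix X X ℂ}
    {f : ℕ → ℂ} (hf : ∀ y w, B y w = f (Γ.dist y w)) {t : ℂ} (ht : Γ.adjA * B = t • B) :
    ((Γ.bNumber 0 : ℂ) - Γ.bNumber h) * f (h - 1) + Γ.bNumber h * f (h + 1) = t * f h := by
  obtain ⟨y, w, hyw⟩ := hΓ.1.exists_dist_eq hh.le
  have e := congrFun (congrFun ht y) w
  rw [adjA_mul_apply, Matrix.smul_apply, hf, hyw, smul_eq_mul] at e
  have hc := hΓ.card_filter_pred hbip h0 hh hyw
  classical
  have hs : (Finset.univ.filter fun z => Γ.dist y z = 1) =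
      (Finset.univ.filter fun z => Γ.dist y z = 1 ∧ Γ.dist z w = h - 1) ∪
      (Finset.univ.filter fun z => Γ.dist y z = 1 ∧ Γ.dist z w = h + 1) := by
    ext z
    simp only [Finset.mem_union, Finset.mem_filter, Finset.mem_univ, true_and]
    refine ⟨fun hz => ?_, by tauto⟩
    have := hΓ.dist_eq_or_of_adj hbip w hz
    rw [hyw] at this
    tauto
  rw [← e, hs, Finset.sum_union]
  · rw [← hc, Nat.cast_add, add_sub_cancel_right, hΓ.bNumber_eq hh hyw,
      ← nsmul_eq_mul, ← nsmul_eq_mul, ← Finset.sum_const, ← Finset.sum_const]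
    congr 1 <;> refine Finset.sum_congr rfl fun z hz => ?_ <;>
      rw [hf, (Finset.mem_filter.1 hz).2.2]
  · rw [Finset.disjoint_left]
    intro z
    simp only [Finset.mem_filter, Finset.mem_univ, true_and]
    omega

end IsDistanceRegular

end DistanceClasses

/-! ### The spectrum of the adjacency matrix -/

section Spectrum

theorem adjA_isHermitian (Γ : SimpleGraph X) : Γ.adjA.IsHermitian := by
  ext y z
  rw [Matrix.conjTranspose_apply]
  simp only [adjA, distMatrix, Matrix.of_apply, Γ.dist_comm (u := z)]
  split_ifs <;> simp

theorem adjA_eq_adjMatrix (Γ : SimpleGraph X) [DecidableRel Γ.Adj] : Γ.adjA = Γ.adjMatrix ℂ := by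
  ext y z
  rw [adjA_apply, adjMatrix_apply]

variable [Fintype X] [DecidableEq X]

theorem mem_eigenvalueFinset {Γ : SimpleGraph X} {s : ℝ} :
    s ∈ Γ.eigenvalueFinset ↔ ∃ v : X → ℂ, v ≠ 0 ∧ Γ.adjA.mulVec v = (s : ℂ) • v := by
  rw [eigenvalueFinset, Set.Finite.mem_toFinset, Set.mem_ofPred_eq]
  constructor
  · intro h
    obtain ⟨v, hv⟩ := h.exists_hasEigenvector
    exact ⟨v, hv.2, by simpa using hv.apply_eq_smul⟩
  · rintro ⟨v, hv, h⟩
    exact Module.End.hasEigenvalue_of_hasEigenvector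
      (x := v) ⟨Module.End.mem_eigenspace_iff.2 (by simpa using h), hv⟩

theorem aeval_adjA_mulVec (Γ : SimpleGraph X) (p : ℂ[X]) {s : ℂ} {v : X → ℂ}
    (hv : Γ.adjA.mulVec v = s • v) : (aeval Γ.adjA p).mulVec v = p.eval s • v := by
  rw [← Matrix.toLinAlgEquiv'_apply, ← aeval_algHom_apply,
    Module.End.aeval_apply_of_mem_apply_eq_smul (μ := s)]
  exact hv

/-- `A` is diagonalisable: a matrix that vanishes on all its eigenvectors is zero. -/
theorem eq_zero_of_forall_eigenvector {Γ : SimpleGraph X} {B : Matrix X X ℂ}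
    (h : ∀ s ∈ Γ.eigenvalueFinset, ∀ v, Γ.adjA.mulVec v = (s : ℂ) • v → B.mulVec v = 0) :
    B = 0 := by
  let b := Γ.adjA_isHermitian.eigenvectorBasis
  have hb : ∀ j, B.mulVec (b j) = 0 := by
    intro j
    have hj : Γ.adjA.mulVec (b j) = ((Γ.adjA_isHermitian.eigenvalues j : ℝ) : ℂ) • ⇑(b j) := by
      rw [Γ.adjA_isHermitian.mulVec_eigenvectorBasis j]
      ext; simp [b]
    refine h _ (mem_eigenvalueFinset.2 ⟨b j, fun h0 => ?_, hj⟩) _ hj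
    exact b.orthonormal.ne_zero j (by ext i; exact congrFun h0 i)
  have : B.toLpLin 2 2 = 0 := by
    refine b.toBasis.ext fun j => ?_
    ext i
    simpa [Matrix.toLpLin_apply] using congrFun (hb j) i
  simpa using this

/-- Gershgorin: the discs are centred at the zero diagonal and have radius at most the valency. -/
theorem abs_le_bNumber_zero {Γ : SimpleGraph X} (hΓ : Γ.IsDistanceRegular) (hD : 0 < Γ.diam)
    {s : ℝ} (hs : s ∈ Γ.eigenvalueFinset) : |s| ≤ Γ.bNumber 0 := by
  rw [eigenvalueFinset, Set.Finite.mem_toFinset, Set.mem_ofPred_eq] at hs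
  obtain ⟨y, hy⟩ := eigenvalue_mem_ball hs
  have h0 : Γ.adjA y y = 0 := by simp [adjA, distMatrix]
  rw [h0, mem_closedBall_zero_iff, Complex.norm_real, Real.norm_eq_abs] at hy
  refine hy.trans ?_
  rw [hΓ.bNumber_zero_eq hD y, Finset.card_filter, Nat.cast_sum]
  refine (Finset.sum_le_sum_of_subset_of_nonneg (Finset.erase_subset _ _)
    fun _ _ _ => norm_nonneg _).trans (Finset.sum_le_sum fun z _ => ?_)
  simp only [adjA, distMatrix, Matrix.of_apply]
  split_ifs <;> simp

theorem bNumber_zero_mem_eigenvalueFinset {Γ : SimpleGraph X} (hΓ : Γ.IsDistanceRegular)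
    (hD : 0 < Γ.diam) : (Γ.bNumber 0 : ℝ) ∈ Γ.eigenvalueFinset := by
  have := hΓ.1.nonempty
  refine mem_eigenvalueFinset.2 ⟨1, one_ne_zero, ?_⟩
  ext y
  rw [adjA_mulVec_apply, hΓ.bNumber_zero_eq hD y]
  simp

/-- Flipping the sign of an eigenvector on one colour class negates its eigenvalue. -/
theorem neg_mem_eigenvalueFinset {Γ : SimpleGraph X} (hc : Γ.Connected) (hbip : Γ.IsBipartite)
    {s : ℝ} (hs : s ∈ Γ.eigenvalueFinset) : -s ∈ Γ.eigenvalueFinset := by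
  obtain ⟨c, h⟩ := hbip.exists_even_dist_iff hc
  obtain ⟨v, hv, hs⟩ := mem_eigenvalueFinset.1 hs
  refine mem_eigenvalueFinset.2 ⟨fun y => if c y then v y else - v y, fun h0 => hv ?_, ?_⟩
  · ext y
    have := congrFun h0 y
    by_cases hy : c y <;> simpa [hy] using this
  · ext y
    have hy := congrFun hs y
    rw [adjA_mulVec_apply] at hy ⊢
    have hz : ∀ z ∈ Finset.univ.filter (fun z => Γ.dist y z = 1),
        (if c z then v z else - v z) = (if c y then -1 else 1) * v z := by
      intro z hz
      have := h y z
      rw [(Finset.mem_filter.1 hz).2] at this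
      by_cases h1 : c y <;> by_cases h2 : c z <;> simp [h1, h2] at this ⊢
    rw [Finset.sum_congr rfl hz, ← Finset.mul_sum, hy]
    by_cases h1 : c y <;> simp [h1]

/-! ### The number of distinct eigenvalues is D + 1 -/

theorem adjA_pow_apply_eq_zero {Γ : SimpleGraph X} {n : ℕ} {y w : X} (h : n < Γ.dist y w) :
    (Γ.adjA ^ n) y w = 0 := by
  classical
  rw [adjA_eq_adjMatrix, adjMatrix_pow_apply_eq_card_walk, Nat.cast_eq_zero, Fintype.card_eq_zero_iff]
  exact ⟨fun p => by have := dist_le p.1; have h2 : p.1.length = n := p.2; omega⟩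

theorem adjA_pow_dist_apply_ne_zero {Γ : SimpleGraph X} (hc : Γ.Connected) (y w : X) :
    (Γ.adjA ^ Γ.dist y w) y w ≠ 0 := by
  classical
  obtain ⟨p, hp⟩ := hc.exists_walk_length_eq_dist y w
  rw [adjA_eq_adjMatrix, adjMatrix_pow_apply_eq_card_walk, Nat.cast_ne_zero]
  have : Nonempty {p : Γ.Walk y w | p.length = Γ.dist y w} := ⟨⟨p, hp⟩⟩
  exact Fintype.card_ne_zero

/-- If n = deg p ≤ D, then at a pair at distance n only the leading power of A contributes to p(A),
and it counts a positive number of walks. -/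
theorem lt_natDegree_of_aeval_adjA_eq_zero {Γ : SimpleGraph X} (hc : Γ.Connected) {p : ℂ[X]}
    (hp : p ≠ 0) (h : aeval Γ.adjA p = 0) : Γ.diam < p.natDegree := by
  by_contra! hle
  obtain ⟨y, w, hyw⟩ := hc.exists_dist_eq hle
  have h0 := congrFun (congrFun h y) w
  rw [aeval_eq_sum_range, Matrix.sum_apply, Finset.sum_range_succ, Finset.sum_eq_zero, zero_add,
    Matrix.smul_apply, Matrix.zero_apply, smul_eq_mul, mul_eq_zero] at h0
  · rcases h0 with h0 | h0
    · exact hp (leadingCoeff_eq_zero.1 h0)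
    · exact adjA_pow_dist_apply_ne_zero hc y w (hyw ▸ h0)
  · intro n hn
    rw [Matrix.smul_apply, adjA_pow_apply_eq_zero (hyw ▸ Finset.mem_range.1 hn), smul_zero]

theorem diam_lt_card_eigenvalueFinset {Γ : SimpleGraph X} (hc : Γ.Connected) :
    Γ.diam < Γ.eigenvalueFinset.card := by
  let p : ℂ[X] := Lagrange.nodal Γ.eigenvalueFinset (fun s => (s : ℂ))
  have hp : aeval Γ.adjA p = 0 := by
    refine eq_zero_of_forall_eigenvector (Γ := Γ) fun s hs v hv => ?_
    rw [aeval_adjA_mulVec Γ p hv, Lagrange.eval_nodal_at_node hs, zero_smul]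
  have := lt_natDegree_of_aeval_adjA_eq_zero hc Lagrange.nodal_ne_zero hp
  rwa [Lagrange.natDegree_nodal] at this

/-- All polynomials in A lie in the span of the D + 1 distance matrices, so some nonzero polynomial
of degree at most D + 1 annihilates A; every eigenvalue is a root of it. -/
theorem card_eigenvalueFinset_le {Γ : SimpleGraph X} (hΓ : Γ.IsDistanceRegular) :
    Γ.eigenvalueFinset.card ≤ Γ.diam + 1 := by
  let S := Submodule.span ℂ (Set.range fun j : Fin (Γ.diam + 1) => Γ.distMatrix j)
  have hS : ∀ p : ℂ[X], aeval Γ.adjA p ∈ S := by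
    intro p
    obtain ⟨f, hf⟩ := hΓ.exists_aeval_adjA_apply p
    have : aeval Γ.adjA p = ∑ j : Fin (Γ.diam + 1), f j • Γ.distMatrix j := by
      ext y w
      rw [hf, Matrix.sum_apply, Finset.sum_eq_single
        ⟨Γ.dist y w, Nat.lt_succ_of_le (hΓ.1.dist_le_diam y w)⟩]
      · simp [distMatrix]
      · intro j _ hj
        have : Γ.dist y w ≠ j := fun h => hj (Fin.ext h.symm)
        simp [distMatrix, this]
      · simp
    rw [this]
    exact sum_mem fun j _ => S.smul_mem _ (Submodule.subset_span ⟨j, rfl⟩)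
  have hfin : Module.finrank ℂ S ≤ Γ.diam + 1 :=
    (finrank_range_le_card (R := ℂ) fun j : Fin (Γ.diam + 1) => Γ.distMatrix j).trans_eq
      (Fintype.card_fin _)
  let φ : degreeLT ℂ (Γ.diam + 2) →ₗ[ℂ] S :=
    ((aeval Γ.adjA).toLinearMap.comp (degreeLT ℂ (Γ.diam + 2)).subtype).codRestrict S
      fun p => hS p
  have : Module.Finite ℂ (degreeLT ℂ (Γ.diam + 2)) :=
    Module.Finite.equiv (degreeLTEquiv ℂ (Γ.diam + 2)).symm
  have hφ : ¬ Function.Injective φ := by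
    intro hφ
    have := LinearMap.finrank_le_finrank_of_injective hφ
    rw [(degreeLTEquiv ℂ (Γ.diam + 2)).finrank_eq, Module.finrank_fin_fun] at this
    omega
  rw [← LinearMap.ker_eq_bot, Submodule.eq_bot_iff] at hφ
  push Not at hφ
  obtain ⟨⟨p, hp⟩, hker, hne⟩ := hφ
  have hp0 : p ≠ 0 := fun h => hne (by ext1; exact h)
  have hA : aeval Γ.adjA p = 0 := congrArg Subtype.val (LinearMap.mem_ker.1 hker)
  have hroots : Γ.eigenvalueFinset.map ⟨((↑) : ℝ → ℂ), Complex.ofReal_injective⟩ ⊆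
      p.roots.toFinset := by
    intro t ht
    obtain ⟨s, hs, rfl⟩ := Finset.mem_map.1 ht
    obtain ⟨v, hv, hsv⟩ := mem_eigenvalueFinset.1 hs
    have h := aeval_adjA_mulVec Γ p hsv
    rw [hA, Matrix.zero_mulVec, eq_comm, smul_eq_zero] at h
    simpa [hp0] using h.resolve_right hv
  have h1 := Finset.card_le_card hroots
  rw [Finset.card_map] at h1
  have h2 := Multiset.toFinset_card_le p.roots
  have h3 := p.card_roots'
  have h4 : p.natDegree < Γ.diam + 2 := by
    rw [natDegree_lt_iff_degree_lt hp0]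
    exact mem_degreeLT.1 hp
  omega

theorem card_eigenvalueFinset {Γ : SimpleGraph X} (hΓ : Γ.IsDistanceRegular) :
    Γ.eigenvalueFinset.card = Γ.diam + 1 :=
  le_antisymm (card_eigenvalueFinset_le hΓ) (diam_lt_card_eigenvalueFinset hΓ.1)

/-! ### The ordering of the eigenvalues -/

section Theta

variable {Γ : SimpleGraph X} (hΓ : Γ.IsDistanceRegular)
include hΓ

theorem theta_eq_getElem {i : ℕ} (hi : i ≤ Γ.diam) :
    Γ.theta i = (Γ.eigenvalueFinset.sort (fun s t => t ≤ s))[i]'(by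
      rw [Finset.length_sort, card_eigenvalueFinset hΓ]; omega) := by
  rw [theta, List.getD_eq_getElem]

theorem theta_mem {i : ℕ} (hi : i ≤ Γ.diam) : Γ.theta i ∈ Γ.eigenvalueFinset := by
  rw [theta_eq_getElem hΓ hi, ← Finset.mem_sort (fun s t : ℝ => t ≤ s)]
  exact List.getElem_mem _

theorem exists_theta_eq {s : ℝ} (hs : s ∈ Γ.eigenvalueFinset) :
    ∃ i ≤ Γ.diam, Γ.theta i = s := by
  rw [← Finset.mem_sort (fun s t : ℝ => t ≤ s)] at hs
  obtain ⟨i, hi, h⟩ := List.getElem_of_mem hs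
  have hi' : i ≤ Γ.diam := by
    rw [Finset.length_sort, card_eigenvalueFinset hΓ] at hi; omega
  exact ⟨i, hi', by rw [theta_eq_getElem hΓ hi', h]⟩

theorem theta_lt_theta {i j : ℕ} (hij : i < j) (hj : j ≤ Γ.diam) : Γ.theta j < Γ.theta i := by
  rw [theta_eq_getElem hΓ hj, theta_eq_getElem hΓ (hij.le.trans hj)]
  refine lt_of_le_of_ne ?_ fun h => ?_
  · exact List.pairwise_iff_getElem.1
      (Finset.pairwise_sort Γ.eigenvalueFinset (fun s t => t ≤ s)) _ _ _ _ hij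
  · have := (List.Nodup.getElem_inj_iff (Finset.sort_nodup _ _)).1 h
    omega

theorem theta_le_theta {i j : ℕ} (hij : i ≤ j) (hj : j ≤ Γ.diam) : Γ.theta j ≤ Γ.theta i := by
  rcases hij.eq_or_lt with rfl | h
  · exact le_rfl
  · exact (theta_lt_theta hΓ h hj).le

theorem theta_injOn {i j : ℕ} (hi : i ≤ Γ.diam) (hj : j ≤ Γ.diam)
    (h : Γ.theta i = Γ.theta j) : i = j := by
  rcases lt_trichotomy i j with hij | hij | hij
  · exact absurd h (theta_lt_theta hΓ hij hj).ne'
  · exact hij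
  · exact absurd h (theta_lt_theta hΓ hij hi).ne

theorem theta_zero (hD : 0 < Γ.diam) : Γ.theta 0 = Γ.bNumber 0 := by
  obtain ⟨i, hi, h⟩ := exists_theta_eq hΓ (bNumber_zero_mem_eigenvalueFinset hΓ hD)
  refine le_antisymm ?_ ?_
  · exact (le_abs_self _).trans (abs_le_bNumber_zero hΓ hD (theta_mem hΓ (Nat.zero_le _)))
  · rw [← h]
    exact theta_le_theta hΓ (Nat.zero_le _) hi

/-- The spectrum is symmetric about 0, so negating and reversing the decreasing list of eigenvalues
gives the same list. -/
theorem theta_diam_sub (hbip : Γ.IsBipartite) {i : ℕ} (hi : i ≤ Γ.diam) :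
    Γ.theta (Γ.diam - i) = -Γ.theta i := by
  set l := Γ.eigenvalueFinset.sort (fun s t => t ≤ s) with hl
  have hlen : l.length = Γ.diam + 1 := by rw [hl, Finset.length_sort, card_eigenvalueFinset hΓ]
  have hp : l.Pairwise (fun s t => t ≤ s) := Finset.pairwise_sort _ _
  have hnd : l.Nodup := Finset.sort_nodup _ _
  have hp' : (l.map Neg.neg).reverse.Pairwise (fun s t => t ≤ s) := by
    rw [List.pairwise_reverse, List.pairwise_map]
    exact hp.imp fun h => by simpa using h
  have hmem : ∀ s ∈ l, -s ∈ l := fun s hs => by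
    rw [hl, Finset.mem_sort] at hs ⊢
    exact neg_mem_eigenvalueFinset hΓ.1 hbip hs
  have hperm : (l.map Neg.neg).reverse.Perm l := by
    refine (List.perm_ext_iff_of_nodup ?_ hnd).2 fun s => ?_
    · rw [List.nodup_reverse]
      exact hnd.map neg_injective
    · rw [List.mem_reverse, List.mem_map]
      exact ⟨by rintro ⟨t, ht, rfl⟩; exact hmem t ht, fun hs => ⟨-s, hmem s hs, neg_neg s⟩⟩
  have heq : (l.map Neg.neg).reverse = l := hperm.eq_of_pairwise' hp' hp
  rw [theta_eq_getElem hΓ hi, theta_eq_getElem hΓ (Nat.sub_le _ _)]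
  have : l[Γ.diam - i]'(by omega) = (l.map Neg.neg).reverse[Γ.diam - i]'(by simp; omega) := by
    simp only [heq]
  rw [this, List.getElem_reverse, List.getElem_map]
  congr 2
  simp [hlen]
  omega

theorem sq_theta_lt (hbip : Γ.IsBipartite) {i : ℕ} (h1 : 1 ≤ i) (hi : i + 1 ≤ Γ.diam) :
    Γ.theta i ^ 2 < (Γ.bNumber 0 : ℝ) ^ 2 := by
  have h0 := theta_zero hΓ (by omega)
  have hD := theta_diam_sub hΓ hbip (Nat.zero_le Γ.diam)
  rw [Nat.sub_zero, h0] at hD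
  refine sq_lt_sq' ?_ ?_
  · rw [← hD]
    exact theta_lt_theta hΓ hi le_rfl
  · rw [← h0]
    exact theta_lt_theta hΓ h1 (by omega)

theorem sq_theta_le_sq_theta_one (hbip : Γ.IsBipartite) {i : ℕ} (h1 : 1 ≤ i)
    (hi : i + 1 ≤ Γ.diam) : Γ.theta i ^ 2 ≤ Γ.theta 1 ^ 2 := by
  have h := theta_le_theta hΓ h1 (by omega : i ≤ Γ.diam)
  have h' := theta_le_theta hΓ (by omega : 1 ≤ Γ.diam - i) (Nat.sub_le _ _)
  rw [theta_diam_sub hΓ hbip (by omega)] at h'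
  exact sq_le_sq' (by linarith) h

theorem sq_theta_half_le (hbip : Γ.IsBipartite) {i : ℕ} (hi : i ≤ Γ.diam) :
    Γ.theta (Γ.diam / 2) ^ 2 ≤ Γ.theta i ^ 2 := by
  have h0 := theta_diam_sub hΓ hbip (by omega : Γ.diam / 2 ≤ Γ.diam)
  -- After the rewrite this reads -θ_d ≤ θ_d, so θ_d is nonnegative.
  have h1 := theta_le_theta hΓ (by omega : Γ.diam / 2 ≤ Γ.diam - Γ.diam / 2) (Nat.sub_le _ _)
  rw [h0] at h1
  rcases le_or_gt i (Γ.diam / 2) with h | h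
  · have := theta_le_theta hΓ h (by omega)
    exact sq_le_sq' (by linarith) this
  · have := theta_le_theta hΓ (by omega : Γ.diam - Γ.diam / 2 ≤ i) hi
    rw [h0] at this
    nlinarith

/-! ### The primitive idempotents -/

theorem primIdem_mulVec_theta {i j : ℕ} (hi : i ≤ Γ.diam) (hj : j ≤ Γ.diam) {v : X → ℂ}
    (hv : Γ.adjA.mulVec v = (Γ.theta j : ℂ) • v) :
    (Γ.primIdem i).mulVec v = if i = j then v else 0 := by
  split_ifs with h
  · subst h
    exact primIdem_mulVec_self Γ (theta_mem hΓ hi) hv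
  · exact primIdem_mulVec_of_ne Γ (theta_mem hΓ hj) (fun h' => h (theta_injOn hΓ hi hj h'.symm)) hv

theorem adjA_mul_primIdem {i : ℕ} (hi : i ≤ Γ.diam) :
    Γ.adjA * Γ.primIdem i = (Γ.theta i : ℂ) • Γ.primIdem i := by
  rw [← sub_eq_zero]
  refine eq_zero_of_forall_eigenvector (Γ := Γ) fun s hs v hv => ?_
  obtain ⟨j, hj, rfl⟩ := exists_theta_eq hΓ hs
  rw [Matrix.sub_mulVec, ← Matrix.mulVec_mulVec, Matrix.smul_mulVec,
    primIdem_mulVec_theta hΓ hi hj hv]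
  split_ifs with h
  · subst h
    rw [hv, sub_self]
  · simp

theorem adjA_mulVec_primIdem_mulVec {i : ℕ} (hi : i ≤ Γ.diam) (v : X → ℂ) :
    Γ.adjA.mulVec ((Γ.primIdem i).mulVec v) = (Γ.theta i : ℂ) • (Γ.primIdem i).mulVec v := by
  rw [Matrix.mulVec_mulVec, adjA_mul_primIdem hΓ hi, Matrix.smul_mulVec]

theorem primIdem_ne_zero {i : ℕ} (hi : i ≤ Γ.diam) : Γ.primIdem i ≠ 0 := by
  obtain ⟨v, hv, h⟩ := mem_eigenvalueFinset.1 (theta_mem hΓ hi)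
  intro h0
  have := primIdem_mulVec_self Γ (theta_mem hΓ hi) h
  rw [h0, Matrix.zero_mulVec] at this
  exact hv this.symm

end Theta

theorem aeval_adjA_mem_boseMesner (Γ : SimpleGraph X) (p : ℂ[X]) :
    aeval Γ.adjA p ∈ Γ.boseMesner :=
  aeval_mem_adjoin_singleton ℂ Γ.adjA

theorem primIdem_mem_boseMesner (Γ : SimpleGraph X) (i : ℕ) : Γ.primIdem i ∈ Γ.boseMesner :=
  aeval_adjA_mem_boseMesner Γ _

theorem boseMesner_le_subconstituentAlgebra (Γ : SimpleGraph X) (x : X) :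
    Γ.boseMesner ≤ Γ.subconstituentAlgebra x :=
  Algebra.adjoin_mono Set.subset_union_left

end Spectrum

/-! ### The entries of the primitive idempotents -/

/-- The recurrence determines f₁, …, f₄ from f₀ (for instance k(k - 1) f₂ = (t² - k) f₀); the
denominators are cleared so that no nonvanishing is needed. -/
theorem three_term_identity {k b₁ b₂ b₃ t η f₀ f₁ f₂ f₃ f₄ : ℂ} (hb : 1 + b₁ = k)
    (h₀ : k * f₁ = t * f₀) (h₁ : (k - b₁) * f₀ + b₁ * f₂ = t * f₁)
    (h₂ : (k - b₂) * f₁ + b₂ * f₃ = t * f₂) (h₃ : (k - b₃) * f₂ + b₃ * f₄ = t * f₃) :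
    b₂ * b₃ * k * (k - 1) * (f₀ + η * f₂ - (1 + η) * f₄) =
      f₀ * (k ^ 2 - t ^ 2) * ((1 + η) * (t ^ 2 - b₂) + b₂ * b₃) := by
  obtain rfl : b₁ = k - 1 := by linear_combination hb
  linear_combination (η * b₂ * b₃ - (1 + η) * (t ^ 2 - b₂ * (k - b₃))) * (k * h₁ + t * h₀)
    - (1 + η) * b₂ * k * (k - 1) * h₃ - (1 + η) * k * (k - 1) * t * h₂
    + (1 + η) * (k - 1) * t * (k - b₂) * h₀

theorem pow_eq_pow_of_even_iff {ε : ℂ} (hε : ε ^ 2 = 1) {m n : ℕ} (h : Even m ↔ Even n) :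
    ε ^ m = ε ^ n := by
  have key : ∀ n, ε ^ n = if Even n then 1 else ε := by
    intro n
    split_ifs with hn
    · obtain ⟨r, rfl⟩ := hn.two_dvd
      rw [pow_mul, hε, one_pow]
    · obtain ⟨r, rfl⟩ := Nat.not_even_iff_odd.1 hn
      rw [pow_succ, pow_mul, hε, one_pow, one_mul]
  rw [key, key, if_congr h rfl rfl]

/-! ### Action of the idempotents on vectors supported on a sphere -/

section Idempotents

variable [Fintype X]

namespace IsDistanceRegular

variable {Γ : SimpleGraph X} (hΓ : Γ.IsDistanceRegular) (hbip : Γ.IsBipartite)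
include hΓ hbip

/-- Since every b_h with h < D is nonzero, the recurrence propagates the zero. Applied to E_i ≠ 0,
this gives f 0 ≠ 0. -/
theorem eq_zero_of_recurrence {B : Matrix X X ℂ} {f : ℕ → ℂ}
    (hf : ∀ y w, B y w = f (Γ.dist y w)) {t : ℂ} (ht : Γ.adjA * B = t • B) (h0 : f 0 = 0) :
    B = 0 := by
  have key : ∀ n ≤ Γ.diam, f n = 0 := by
    intro n
    induction n using Nat.strong_induction_on with
    | _ n ih =>
      intro hn
      match n with
      | 0 => exact h0
      | 1 =>
        have h := hΓ.recurrence_zero hn hf ht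
        rw [h0, mul_zero, mul_eq_zero, Nat.cast_eq_zero] at h
        exact h.resolve_left (hΓ.bNumber_pos hn).ne'
      | m + 2 =>
        have h := hΓ.recurrence hbip (h := m + 1) m.succ_pos hn hf ht
        rw [Nat.add_sub_cancel, ih m (by omega) (by omega), ih (m + 1) (by omega) (by omega),
          mul_zero, mul_zero, zero_add, mul_eq_zero, Nat.cast_eq_zero] at h
        exact h.resolve_left (hΓ.bNumber_pos hn).ne'
  ext y w
  rw [hf, key _ (hΓ.1.dist_le_diam y w), Matrix.zero_apply]

/-- With t = ±k the recurrence is solved by powers of the sign, because its two coefficients add up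
to k. -/
theorem eq_pow_mul_of_recurrence {B : Matrix X X ℂ} {f : ℕ → ℂ}
    (hf : ∀ y w, B y w = f (Γ.dist y w)) {ε : ℂ} (hε : ε ^ 2 = 1)
    (ht : Γ.adjA * B = (ε * Γ.bNumber 0) • B) : ∀ n ≤ Γ.diam, f n = ε ^ n * f 0 := by
  intro n
  induction n using Nat.strong_induction_on with
  | _ n ih =>
    intro hn
    match n with
    | 0 => simp
    | 1 =>
      have h := hΓ.recurrence_zero hn hf ht
      have hb : (Γ.bNumber 0 : ℂ) ≠ 0 := Nat.cast_ne_zero.2 (hΓ.bNumber_pos hn).ne'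
      refine mul_left_cancel₀ hb ?_
      rw [h]
      ring
    | m + 2 =>
      have h := hΓ.recurrence hbip (h := m + 1) m.succ_pos hn hf ht
      have hb : (Γ.bNumber (m + 1) : ℂ) ≠ 0 := Nat.cast_ne_zero.2 (hΓ.bNumber_pos hn).ne'
      rw [Nat.add_sub_cancel, ih m (by omega) (by omega), ih (m + 1) (by omega) (by omega)] at h
      refine mul_left_cancel₀ hb ?_
      linear_combination h + Γ.bNumber 0 * ε ^ m * f 0 * hε
        - Γ.bNumber (m + 1) * ε ^ m * f 0 * hε

/-- A multiple of `E_0` or `E_D` kills the vectors supported on a sphere that sum to zero. -/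
theorem mulVec_eq_zero_of_recurrence {B : Matrix X X ℂ} {f : ℕ → ℂ}
    (hf : ∀ y w, B y w = f (Γ.dist y w)) {ε : ℂ} (hε : ε ^ 2 = 1)
    (ht : Γ.adjA * B = (ε * Γ.bNumber 0) • B) {x : X} {r : ℕ} {v : X → ℂ}
    (hv : ∀ z, Γ.dist x z ≠ r → v z = 0) (hsum : ∑ z, v z = 0) : B.mulVec v = 0 := by
  ext y
  -- On the support of v, ∂(y, z) has the parity of ∂(x, y) + r, so the sign does not depend on z.
  have h : ∀ z, B y z * v z = ε ^ (Γ.dist x y + r) * f 0 * v z := by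
    intro z
    by_cases hz : Γ.dist x z = r
    · rw [hf, hΓ.eq_pow_mul_of_recurrence hbip hf hε ht _ (hΓ.1.dist_le_diam y z),
        pow_eq_pow_of_even_iff hε (n := Γ.dist x y + r)]
      rw [hbip.even_dist_iff hΓ.1 x y z, hz, Nat.even_add]
    · rw [hv z hz, mul_zero, mul_zero]
  simp only [Matrix.mulVec, dotProduct, Pi.zero_apply]
  rw [Finset.sum_congr rfl fun z _ => h z, ← Finset.mul_sum, hsum, mul_zero]

/-- Within the sphere of radius 2, B agrees with f 0 I + f 2 A_2 + f 4 (J - I - A_2), where J is the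
all-ones matrix and J v = 0. -/
theorem mulVec_apply_of_dist_eq_two [DecidableEq X] {B : Matrix X X ℂ} {f : ℕ → ℂ}
    (hf : ∀ y w, B y w = f (Γ.dist y w)) {x : X} {v : X → ℂ}
    (hv : ∀ z, Γ.dist x z ≠ 2 → v z = 0) (hsum : ∑ z, v z = 0) {η : ℂ} {y : X}
    (hy : Γ.dist x y = 2) (hη : (Γ.distMatrix 2).mulVec v y = η * v y) :
    B.mulVec v y = (f 0 + η * f 2 - (1 + η) * f 4) * v y := by
  have h : ∀ z, B y z * v z = (f 0 - f 4) * ((if y = z then 1 else 0) * v z) +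
      (f 2 - f 4) * (Γ.distMatrix 2 y z * v z) + f 4 * v z := by
    intro z
    by_cases hz : Γ.dist x z = 2
    · have he := hbip.even_dist_iff hΓ.1 x y z
      have hle : Γ.dist y z ≤ Γ.dist y x + Γ.dist x z := hΓ.1.dist_triangle
      rw [Γ.dist_comm (u := y) (v := x), hy, hz] at hle
      rw [hy, hz, iff_true_right Iff.rfl] at he
      have hcases : Γ.dist y z = 0 ∨ Γ.dist y z = 2 ∨ Γ.dist y z = 4 := by
        obtain ⟨r, hr⟩ := he
        omega
      rw [hf]
      simp only [distMatrix, Matrix.of_apply, ← hΓ.1.dist_eq_zero_iff]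
      rcases hcases with h | h | h <;> simp [h] <;> ring
    · simp [hv z hz]
  have h2 : (Γ.distMatrix 2).mulVec v y = ∑ z, Γ.distMatrix 2 y z * v z := rfl
  rw [h2] at hη
  simp only [Matrix.mulVec, dotProduct]
  rw [Finset.sum_congr rfl fun z _ => h z, Finset.sum_add_distrib, Finset.sum_add_distrib,
    ← Finset.mul_sum, ← Finset.mul_sum, ← Finset.mul_sum, hη, hsum]
  simp only [ite_mul, one_mul, zero_mul, Finset.sum_ite_eq, Finset.mem_univ, if_true]
  ring

theorem primIdem_mulVec_ne_zero [DecidableEq X] (hD : 4 ≤ Γ.diam) {x : X} {v : X → ℂ}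
    (hv0 : v ≠ 0) (hv : ∀ z, Γ.dist x z ≠ 2 → v z = 0) (hsum : ∑ z, v z = 0) {η : ℝ}
    (hη : ∀ y, Γ.dist x y = 2 → (Γ.distMatrix 2).mulVec v y = η * v y)
    (hη₁ : Γ.tilde (Γ.theta 1) < η) (hη₂ : η < Γ.tilde (Γ.theta (Γ.diam / 2)))
    {i : ℕ} (h1 : 1 ≤ i) (hi : i + 1 ≤ Γ.diam) : (Γ.primIdem i).mulVec v ≠ 0 := by
  intro h0
  obtain ⟨f, hf⟩ : ∃ f : ℕ → ℂ, ∀ y w, Γ.primIdem i y w = f (Γ.dist y w) :=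
    hΓ.exists_aeval_adjA_apply _
  have ht := adjA_mul_primIdem hΓ (by omega : i ≤ Γ.diam)
  have hf0 : f 0 ≠ 0 := fun h =>
    primIdem_ne_zero hΓ (by omega : i ≤ Γ.diam) (hΓ.eq_zero_of_recurrence hbip hf ht h)
  obtain ⟨y, hy⟩ := Function.ne_iff.1 hv0
  have hy2 : Γ.dist x y = 2 := by
    by_contra h
    exact hy (hv y h)
  have hval := hΓ.mulVec_apply_of_dist_eq_two hbip hf hv hsum hy2 (hη y hy2)
  rw [h0, Pi.zero_apply, eq_comm, mul_eq_zero] at hval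
  have hid := three_term_identity (η := η)
    (by exact_mod_cast hΓ.bNumber_one hbip (by omega : 1 < Γ.diam))
    (hΓ.recurrence_zero (by omega) hf ht)
    (hΓ.recurrence hbip one_pos (by omega) hf ht)
    (hΓ.recurrence hbip two_pos (by omega) hf ht)
    (hΓ.recurrence hbip three_pos (by omega) hf ht)
  rw [hval.resolve_right hy, mul_zero, eq_comm, mul_eq_zero, mul_eq_zero,
    or_iff_right hf0] at hid
  norm_cast at hid
  have hlt := sq_theta_lt hΓ hbip h1 hi
  -- The factor k² - θ_i² is positive because i is neither 0 nor D.
  have hbr : (1 + η) * (Γ.theta i ^ 2 - Γ.bNumber 2) + Γ.bNumber 2 * Γ.bNumber 3 = 0 := by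
    refine (?_ : _ ∨ _).resolve_left (sub_pos.2 hlt).ne'
    exact_mod_cast hid
  have hpos : (0 : ℝ) < Γ.bNumber 2 * Γ.bNumber 3 :=
    mul_pos (Nat.cast_pos.2 (hΓ.bNumber_pos (by omega))) (Nat.cast_pos.2 (hΓ.bNumber_pos (by omega)))
  have hm1 := sq_theta_le_sq_theta_one hΓ hbip h1 hi
  have hm2 := sq_theta_half_le hΓ hbip (by omega : i ≤ Γ.diam)
  have hηi : Γ.theta i ^ 2 - Γ.bNumber 2 ≠ 0 →
      η = -1 - Γ.bNumber 2 * Γ.bNumber 3 / (Γ.theta i ^ 2 - Γ.bNumber 2) := by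
    intro hne
    field_simp
    linarith
  unfold tilde at hη₁ hη₂
  -- The tilde increases with z² on each side of b_2. Below b_2, θ_d² ≤ θ_i² gives η at least the
  -- tilde of θ_d; above b_2, θ_i² ≤ θ_1² gives η at most the tilde of θ_1; at b_2 the bracket would
  -- reduce to b_2 b_3 > 0.
  rcases lt_trichotomy (Γ.theta i ^ 2 - Γ.bNumber 2) 0 with h | h | h
  · have : (Γ.bNumber 2 * Γ.bNumber 3 : ℝ) / (Γ.theta i ^ 2 - Γ.bNumber 2) ≤
        Γ.bNumber 2 * Γ.bNumber 3 / (Γ.theta (Γ.diam / 2) ^ 2 - Γ.bNumber 2) := by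
      rw [div_eq_mul_inv, div_eq_mul_inv]
      refine mul_le_mul_of_nonneg_left ?_ hpos.le
      exact (inv_le_inv_of_neg h (by linarith)).2 (by linarith)
    have := hηi h.ne
    linarith
  · rw [h] at hbr
    linarith
  · have : (Γ.bNumber 2 * Γ.bNumber 3 : ℝ) / (Γ.theta 1 ^ 2 - Γ.bNumber 2) ≤
        Γ.bNumber 2 * Γ.bNumber 3 / (Γ.theta i ^ 2 - Γ.bNumber 2) :=
      div_le_div_of_nonneg_left hpos.le h (by linarith)
    have := hηi h.ne'
    linarith

end IsDistanceRegular

end Idempotents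

/-! ### Modules for the subconstituent algebra -/

section Modules

variable [Fintype X] [DecidableEq X] {Γ : SimpleGraph X} {x : X} {W : Submodule ℂ (X → ℂ)}

theorem dualIdem_mulVec_apply (Γ : SimpleGraph X) (x : X) (i : ℕ) (v : X → ℂ) (y : X) :
    (Γ.dualIdem x i).mulVec v y = if Γ.dist x y = i then v y else 0 := by
  rw [dualIdem, Matrix.mulVec_diagonal, ite_mul, one_mul, zero_mul]

theorem apply_eq_zero_of_mem_dualPart {i : ℕ} {v : X → ℂ} (hv : v ∈ Γ.dualPart x i W) {z : X}
    (hz : Γ.dist x z ≠ i) : v z = 0 := by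
  obtain ⟨w, -, rfl⟩ := hv
  rw [Matrix.mulVecLin_apply, dualIdem_mulVec_apply, if_neg hz]

theorem apply_eq_zero_of_dualPart_eq_bot {i : ℕ} (h : Γ.dualPart x i W = ⊥) {v : X → ℂ}
    (hv : v ∈ W) {z : X} (hz : Γ.dist x z = i) : v z = 0 := by
  have h0 : (Γ.dualIdem x i).mulVec v ∈ Γ.dualPart x i W := ⟨v, hv, rfl⟩
  rw [h, Submodule.mem_bot] at h0
  have := congrFun h0 z
  rwa [dualIdem_mulVec_apply, if_pos hz] at this

theorem IsTModule.dualPart_le (hW : Γ.IsTModule x W) {i : ℕ} (hi : i ≤ Γ.diam) :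
    Γ.dualPart x i W ≤ W := by
  rintro _ ⟨w, hw, rfl⟩
  exact hW _ (Algebra.subset_adjoin (Or.inr ⟨i, hi, rfl⟩)) w hw

theorem IsTModule.boseMesnerOrbit_le (hW : Γ.IsTModule x W) {v : X → ℂ} (hv : v ∈ W) :
    Γ.boseMesnerOrbit v ≤ W := by
  rintro _ ⟨B, hB, rfl⟩
  exact hW B (boseMesner_le_subconstituentAlgebra Γ x hB) v hv

/-- The vector A² v lies in W and so vanishes at x; its entry there is the sum of v times the
nonzero number of 2-walks between vertices at distance 2. -/
theorem sum_eq_zero_of_mem_dualPart_two (hΓ : Γ.IsDistanceRegular) (hD : 2 ≤ Γ.diam)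
    (hW : Γ.IsTModule x W) (h0 : Γ.dualPart x 0 W = ⊥) {v : X → ℂ}
    (hv : v ∈ Γ.dualPart x 2 W) : ∑ z, v z = 0 := by
  obtain ⟨f, hf⟩ := hΓ.exists_aeval_adjA_apply (Polynomial.X ^ 2)
  have hf2 : f 2 ≠ 0 := by
    obtain ⟨y, w, hyw⟩ := hΓ.1.exists_dist_eq hD
    have := adjA_pow_dist_apply_ne_zero hΓ.1 y w
    rwa [hyw, ← aeval_X_pow (R := ℂ) Γ.adjA, hf, hyw] at this
  have hmem : (aeval Γ.adjA (Polynomial.X ^ 2 : ℂ[X])).mulVec v ∈ W :=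
    hW.boseMesnerOrbit_le (hW.dualPart_le hD hv) ⟨_, aeval_adjA_mem_boseMesner Γ _, rfl⟩
  have hx := apply_eq_zero_of_dualPart_eq_bot h0 hmem (z := x) dist_self
  have hterm : ∀ z, aeval Γ.adjA (Polynomial.X ^ 2 : ℂ[X]) x z * v z = f 2 * v z := by
    intro z
    by_cases hz : Γ.dist x z = 2
    · rw [hf, hz]
    · rw [apply_eq_zero_of_mem_dualPart hv hz, mul_zero, mul_zero]
  simp only [Matrix.mulVec, dotProduct] at hx
  rw [Finset.sum_congr rfl fun z _ => hterm z, ← Finset.mul_sum, mul_eq_zero] at hx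
  exact hx.resolve_left hf2

/-! ### Dimension counts -/

theorem finrank_le_sum_finrank_dualPart (hc : Γ.Connected) (x : X) (W : Submodule ℂ (X → ℂ)) :
    Module.finrank ℂ W ≤
      ∑ i ∈ Finset.range (Γ.diam + 1), Module.finrank ℂ (Γ.dualPart x i W) := by
  let φ : W →ₗ[ℂ] (i : Fin (Γ.diam + 1)) → Γ.dualPart x i W :=
    LinearMap.pi fun i => (Γ.dualIdem x i).mulVecLin.restrict fun w hw => ⟨w, hw, rfl⟩
  have hφ : Function.Injective φ := by
    rw [← LinearMap.ker_eq_bot, Submodule.eq_bot_iff]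
    intro w hw
    ext z
    have h := congrArg Subtype.val (congrFun (LinearMap.mem_ker.1 hw)
      ⟨Γ.dist x z, Nat.lt_succ_of_le (hc.dist_le_diam x z)⟩)
    have h' : (Γ.dualIdem x (Γ.dist x z)).mulVec w z = 0 := congrFun h z
    rwa [dualIdem_mulVec_apply, if_pos rfl] at h'
  have := LinearMap.finrank_le_finrank_of_injective hφ
  rwa [Module.finrank_pi_fintype,
    Fin.sum_univ_eq_sum_range fun i => Module.finrank ℂ (Γ.dualPart x i W)] at this

theorem sum_range_ite_lt_two (n : ℕ) :
    ∑ i ∈ Finset.range (n + 1), (if i < 2 then 0 else 1) = n - 1 := by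
  induction n with
  | zero => simp
  | succ n ih =>
    rw [Finset.sum_range_succ, ih]
    split_ifs <;> omega

theorem finrank_dualPart_le_ite (hthin : Γ.IsThin x W) (hend : Γ.HasEndpoint x W 2) {i : ℕ}
    (hi : i ≤ Γ.diam) : Module.finrank ℂ (Γ.dualPart x i W) ≤ if i < 2 then 0 else 1 := by
  split_ifs with h
  · have : Γ.dualPart x i W = ⊥ := by
      by_contra hne
      exact absurd (hend.2 ⟨hi, hne⟩) (by omega)
    rw [this, finrank_bot]
  · exact hthin i hi

theorem finrank_le_of_isThin (hc : Γ.Connected) (hthin : Γ.IsThin x W)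
    (hend : Γ.HasEndpoint x W 2) : Module.finrank ℂ W ≤ Γ.diam - 1 := by
  refine (finrank_le_sum_finrank_dualPart hc x W).trans ?_
  rw [← sum_range_ite_lt_two]
  exact Finset.sum_le_sum fun i hi =>
    finrank_dualPart_le_ite hthin hend (Nat.le_of_lt_succ (Finset.mem_range.1 hi))

/-- When the total bound D - 1 is attained, each termwise bound is attained too. -/
theorem finrank_dualPart_eq_one (hc : Γ.Connected) (hthin : Γ.IsThin x W)
    (hend : Γ.HasEndpoint x W 2) (hW : Module.finrank ℂ W = Γ.diam - 1) {i : ℕ} (h2 : 2 ≤ i)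
    (hi : i ≤ Γ.diam) : Module.finrank ℂ (Γ.dualPart x i W) = 1 := by
  have hle : ∀ j ∈ Finset.range (Γ.diam + 1),
      Module.finrank ℂ (Γ.dualPart x j W) ≤ if j < 2 then 0 else 1 := fun j hj =>
    finrank_dualPart_le_ite hthin hend (Nat.le_of_lt_succ (Finset.mem_range.1 hj))
  have hsum := finrank_le_sum_finrank_dualPart hc x W
  rw [hW, ← sum_range_ite_lt_two] at hsum
  have := (Finset.sum_eq_sum_iff_of_le hle).1 (le_antisymm (Finset.sum_le_sum hle) hsum) i
    (Finset.mem_range.2 (Nat.lt_succ_of_le hi))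
  rwa [if_neg (by omega)] at this

theorem HasLocalEigenvalue.distMatrix_mulVec {η : ℝ} (hη : Γ.HasLocalEigenvalue x W η)
    {v : X → ℂ} (hv : v ∈ Γ.dualPart x 2 W) {y : X} (hy : Γ.dist x y = 2) :
    (Γ.distMatrix 2).mulVec v y = η * v y := by
  have hfix : (Γ.dualIdem x 2).mulVec v = v := by
    ext z
    rw [dualIdem_mulVec_apply]
    split_ifs with hz
    · rfl
    · rw [apply_eq_zero_of_mem_dualPart hv hz]
  have h := congrFun (hη.2 v hv) y
  rwa [← Matrix.mulVec_mulVec, hfix, ← Matrix.mulVec_mulVec, dualIdem_mulVec_apply, if_pos hy,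
    Pi.smul_apply, smul_eq_mul] at h

theorem linearIndependent_primIdem_mulVec (hΓ : Γ.IsDistanceRegular) {v : X → ℂ}
    (hv : ∀ i, 1 ≤ i → i + 1 ≤ Γ.diam → (Γ.primIdem i).mulVec v ≠ 0) :
    LinearIndependent ℂ (fun i : Set.Icc 1 (Γ.diam - 1) => (Γ.primIdem i).mulVec v) := by
  refine Module.End.eigenvectors_linearIndependent' (Matrix.toLin' Γ.adjA)
    (fun i : Set.Icc 1 (Γ.diam - 1) => (Γ.theta i : ℂ)) ?_ _ ?_
  · rintro ⟨i, hi⟩ ⟨j, hj⟩ h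
    rw [Set.mem_Icc] at hi hj
    have hi' : i ≤ Γ.diam := by omega
    have hj' : j ≤ Γ.diam := by omega
    exact Subtype.ext (theta_injOn hΓ hi' hj' (Complex.ofReal_injective h))
  · rintro ⟨i, hi⟩
    rw [Set.mem_Icc] at hi
    have hi' : i ≤ Γ.diam := by omega
    refine ⟨Module.End.mem_eigenspace_iff.2 ?_, hv i hi.1 (by omega)⟩
    rw [Matrix.toLin'_apply]
    exact adjA_mulVec_primIdem_mulVec hΓ hi' v

theorem primPart_eq_of_span (hΓ : Γ.IsDistanceRegular) {v : X → ℂ}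
    (hspan : Submodule.span ℂ
      (Set.range fun i : Set.Icc 1 (Γ.diam - 1) => (Γ.primIdem i).mulVec v) = W)
    {i : ℕ} (hi : i ≤ Γ.diam) :
    Γ.primPart i W =
      if 1 ≤ i ∧ i ≤ Γ.diam - 1 then Submodule.span ℂ {(Γ.primIdem i).mulVec v} else ⊥ := by
  have hE : ∀ j : Set.Icc 1 (Γ.diam - 1), (Γ.primIdem i).mulVec ((Γ.primIdem j).mulVec v) =
      if i = j then (Γ.primIdem j).mulVec v else 0 := by
    rintro ⟨j, hj⟩
    rw [Set.mem_Icc] at hj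
    have hj' : j ≤ Γ.diam := by omega
    exact primIdem_mulVec_theta hΓ hi hj' (adjA_mulVec_primIdem_mulVec hΓ hj' v)
  rw [primPart, ← hspan, Submodule.map_span]
  apply le_antisymm
  · rw [Submodule.span_le]
    rintro _ ⟨_, ⟨j, rfl⟩, rfl⟩
    rw [SetLike.mem_coe, Matrix.mulVecLin_apply, hE j]
    by_cases h : i = j
    · rw [if_pos h, if_pos (h ▸ Set.mem_Icc.1 j.2), h]
      exact Submodule.mem_span_singleton_self _
    · rw [if_neg h]
      exact zero_mem _
  · split_ifs with h
    · rw [Submodule.span_singleton_le_iff_mem]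
      refine Submodule.subset_span ⟨_, ⟨⟨i, h⟩, rfl⟩, ?_⟩
      exact (hE ⟨i, h⟩).trans (if_pos rfl)
    · exact bot_le

end Modules

end SimpleGraph

end

/-! ### The main theorem -/

theorem mainTheorem5 {X : Type*} [Fintype X] [DecidableEq X] (Γ : SimpleGraph X)
    (hreg : Γ.IsDistanceRegular) (hbip : Γ.IsBipartite)
    (D : ℕ) (hD : Γ.diam = D) (hD4 : 4 ≤ D) (hk : 3 ≤ Γ.bNumber 0)
    (x : X) (W : Submodule ℂ (X → ℂ))
    (hirr : Γ.IsIrreducibleTModule x W) (hthin : Γ.IsThin x W) (hend : Γ.HasEndpoint x W 2)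
    (η : ℝ) (hη : Γ.HasLocalEigenvalue x W η)
    (hη₁ : Γ.tilde (Γ.theta 1) < η) (hη₂ : η < Γ.tilde (Γ.theta (D / 2))) :
    Module.finrank ℂ W = D - 1 ∧
    (∀ v ∈ Γ.dualPart x 2 W, v ≠ 0 →
      W = Γ.boseMesnerOrbit v ∧
      LinearIndependent ℂ (fun i : Set.Icc 1 (D - 1) => (Γ.primIdem i).mulVec v) ∧
      Submodule.span ℂ (Set.range fun i : Set.Icc 1 (D - 1) => (Γ.primIdem i).mulVec v) = W ∧
      (Γ.primIdem 0).mulVec v = 0 ∧ (Γ.primIdem D).mulVec v = 0) ∧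
    (∀ i ≤ D, (i ≤ 1 → Γ.dualPart x i W = ⊥) ∧
      (2 ≤ i → Module.finrank ℂ (Γ.dualPart x i W) = 1)) ∧
    (∀ i ≤ D, (i = 0 ∨ i = D → Γ.primPart i W = ⊥) ∧
      (1 ≤ i → i ≤ D - 1 → Module.finrank ℂ (Γ.primPart i W) = 1)) := by
  subst hD
  have hW := hirr.1
  have hbot : ∀ i ≤ 1, Γ.dualPart x i W = ⊥ := by
    intro i hi
    by_contra hne
    exact absurd (hend.2 ⟨by omega, hne⟩) (by omega)
  have hsum : ∀ v ∈ Γ.dualPart x 2 W, ∑ z, v z = 0 := fun v hv =>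
    SimpleGraph.sum_eq_zero_of_mem_dualPart_two hreg (by omega) hW (hbot 0 zero_le_one) hv
  have hne : ∀ v ∈ Γ.dualPart x 2 W, v ≠ 0 →
      ∀ i, 1 ≤ i → i + 1 ≤ Γ.diam → (Γ.primIdem i).mulVec v ≠ 0 := fun v hv hv0 i h1 hi =>
    hreg.primIdem_mulVec_ne_zero hbip hD4 hv0
      (fun _ hz => SimpleGraph.apply_eq_zero_of_mem_dualPart hv hz) (hsum v hv)
      (fun _ hy => hη.distMatrix_mulVec hv hy) hη₁ hη₂ h1 hi
  have hmem : ∀ v ∈ Γ.dualPart x 2 W, ∀ i, (Γ.primIdem i).mulVec v ∈ Γ.boseMesnerOrbit v :=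
    fun v _ i => ⟨_, Γ.primIdem_mem_boseMesner i, rfl⟩
  have horb : ∀ v ∈ Γ.dualPart x 2 W, Γ.boseMesnerOrbit v ≤ W := fun v hv =>
    hW.boseMesnerOrbit_le (hW.dualPart_le (by omega) hv)
  have hspan : ∀ v ∈ Γ.dualPart x 2 W, v ≠ 0 →
      Module.finrank ℂ W = Γ.diam - 1 ∧
      Submodule.span ℂ
        (Set.range fun i : Set.Icc 1 (Γ.diam - 1) => (Γ.primIdem i).mulVec v) = W := by
    intro v hv hv0
    have hcard := finrank_span_eq_card
      (SimpleGraph.linearIndependent_primIdem_mulVec hreg (hne v hv hv0))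
    rw [Fintype.card_ofFinset, Nat.card_Icc] at hcard
    have hle : Submodule.span ℂ
        (Set.range fun i : Set.Icc 1 (Γ.diam - 1) => (Γ.primIdem i).mulVec v) ≤ W := by
      rw [Submodule.span_le]
      rintro _ ⟨i, rfl⟩
      exact horb v hv (hmem v hv i)
    have h1 := Submodule.finrank_mono hle
    have h2 := SimpleGraph.finrank_le_of_isThin hreg.1 hthin hend
    exact ⟨by omega, Submodule.eq_of_le_of_finrank_le hle (by omega)⟩
  obtain ⟨u, hu, hu0⟩ := (Submodule.ne_bot_iff _).1 hη.1
  obtain ⟨hdim, hWu⟩ := hspan u hu hu0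
  refine ⟨hdim, fun v hv hv0 => ?_, fun i hi => ⟨hbot i, fun h2 =>
    SimpleGraph.finrank_dualPart_eq_one hreg.1 hthin hend hdim h2 hi⟩, fun i hi => ⟨?_, ?_⟩⟩
  -- One argument for both ends of the spectrum: ε = 1 for θ_0 = k and ε = -1 for θ_D = -k.
  · have hkill : ∀ i ≤ Γ.diam, ∀ ε : ℂ, ε ^ 2 = 1 → (Γ.theta i : ℂ) = ε * Γ.bNumber 0 →
        (Γ.primIdem i).mulVec v = 0 := by
      intro i hi ε hε hθ
      obtain ⟨f, hf⟩ := hreg.exists_aeval_adjA_apply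
        ((Lagrange.basis Γ.eigenvalueFinset id (Γ.theta i)).map (algebraMap ℝ ℂ))
      exact hreg.mulVec_eq_zero_of_recurrence hbip hf hε
        (hθ ▸ SimpleGraph.adjA_mul_primIdem hreg hi)
        (fun _ hz => SimpleGraph.apply_eq_zero_of_mem_dualPart hv hz) (hsum v hv)
    have h0 := SimpleGraph.theta_zero hreg (by omega)
    have hD := SimpleGraph.theta_diam_sub hreg hbip (Nat.zero_le Γ.diam)
    rw [Nat.sub_zero] at hD
    refine ⟨le_antisymm ?_ (horb v hv),
      SimpleGraph.linearIndependent_primIdem_mulVec hreg (hne v hv hv0), (hspan v hv hv0).2,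
      hkill 0 (Nat.zero_le _) 1 (by norm_num) (by rw [h0]; simp),
      hkill Γ.diam le_rfl (-1) (by norm_num) (by rw [hD, h0]; simp)⟩
    rw [← (hspan v hv hv0).2, Submodule.span_le]
    rintro _ ⟨i, rfl⟩
    exact hmem v hv i
  · intro h
    rw [SimpleGraph.primPart_eq_of_span hreg hWu hi, if_neg (by omega)]
  · intro h1 h2
    rw [SimpleGraph.primPart_eq_of_span hreg hWu hi, if_pos ⟨h1, h2⟩]
    exact finrank_span_singleton (hne u hu hu0 i h1 (by omega))
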